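/- Let $\mathfrak g_N=\mathfrak{so}_N$ with $N\ge 3$, or $\mathfrak g_N=\mathfrak{sp}_N$ with $N=2n\ge 2$ even. Index the rows and columns of $N\times N$ complex matrices by $\pm1,\dots,\pm n$ if $N=2n$ and by $0,\pm1,\dots,\pm n$ if $N=2n+1$; put $\theta_{ij}=1$ in the orthogonal case, $\theta_{ij}=\operatorname{sign}(i)\operatorname{sign}(j)$ in the symplectic case, $(E_{ij})^t=\theta_{ij}E_{-j,-i}$ and $F_{ij}=E_{ij}-(E_{ij})^t$. Then $\mathfrak g_N=\{A\in\mathfrak{gl}_N(\mathbb C): A^t=-A\}=\operatorname{span}_{\mathbb C}\{F_{ij}\}$, with the invariant form $(X,Y)=\tfrac12\operatorname{Tr}(XY)$. Let $\{X_\lambda\}_{\lambda\in\Lambda}$ be any basis of $\mathfrak g=\mathfrak g_N$ that is orthonormal for this form. The Yangian $Y_\hbar(\mathfrak g)$ is the unital associative $\mathbb C[\hbar]$-algebra generated by elements $X$ and $J(X)$, $X\in\mathfrak g$, both depending $\mathbb C$-linearly on $X\in\mathfrak g$, with the relations $$X_1X_2-X_2X_1=[X_1,X_2],\qquad [X_1,J(X_2)]=J([X_1,X_2]),$$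 $$[J(X_1),[J(X_2),X_3]]-[X_1,[J(X_2),J(X_3)]]=\hbar^2\sum_{\lambda,\mu,\nu}\alpha_{\lambda\mu\nu}\{X_\lambda,X_\mu,X_\nu\}\qquad(1)$$ for all $X_1,X_2,X_3\in\mathfrak g$, where $\alpha_{\lambda\mu\nu}=([X_1,X_\lambda],[[X_2,X_\mu],[X_3,X_\nu]])$ and $\{x_1,x_2,x_3\}=\tfrac1{24}\sum_{\sigma\in\mathfrak S_3}x_{\sigma(1)}x_{\sigma(2)}x_{\sigma(3)}$. When $\mathfrak g\cong\mathfrak{sl}_2$, relation (1) is replaced by $$[[J(X_1),J(X_2)],[X_3,J(X_4)]]+[[J(X_3),J(X_4)],[X_1,J(X_2)]]=\hbar^2\sum_{\lambda,\mu,\nu}\beta_{\lambda\mu\nu}\{X_\lambda,X_\mu,J(X_\nu)\}\qquad(2)$$ for all $X_1,\dots,X_4\in\mathfrak g$, where $\beta_{\lambda\mu\nu}=([X_1,X_\lambda],[[X_2,X_\mu],[[X_3,X_4],X_\nu]])+([X_3,X_\lambda],[[X_4,X_\mu],[[X_1,X_2],X_\nu]])$. When $\mathfrak g$ is not simple but has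 an ideal isomorphic to $\mathfrak{sl}_2$ (that is, for $\mathfrak g=\mathfrak{so}_4\cong\mathfrak{sl}_2\oplus\mathfrak{sl}_2$), both (1) and (2) are imposed. For $\zeta\in\mathbb C$ put $Y_\zeta(\mathfrak g)=Y_\hbar(\mathfrak g)/(\hbar-\zeta)Y_\hbar(\mathfrak g)$, a unital associative $\mathbb C$-algebra. **Proposition.** For every $\zeta\in\mathbb C$, the natural representation of $\mathfrak g_N$ on $\mathbb C^N$ extends to a representation of $Y_\zeta(\mathfrak g_N)$ in which every $J(X)$ acts by $0$: there is a homomorphism of unital $\mathbb C$-algebras $\rho:Y_\zeta(\mathfrak g_N)\to\operatorname{End}(\mathbb C^N)$ such that, for all $X\in\mathfrak g_N$, $\rho(X)$ is the natural action of the matrix $X$ on $\mathbb C^N$ and $\rho(J(X))=0$. -/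

import Mathlib

open scoped Polynomial

noncomputable section

namespace DrinfeldYangian

attribute [local instance 100] LieRing.ofAssociativeRing

/-! ### The orthogonal and symplectic Lie algebras -/

/-- The two series of Lie algebras. -/
inductive Series
  | orthogonal
  | symplectic

/-- The labels of rows and columns: with `n = ⌊N/2⌋`, these are `±1, …, ±n` if `N` is even and
`0, ±1, …, ±n` if `N` is odd. -/
abbrev Label (N : ℕ) : Type :=
  {i : ℤ // i ∈ (Finset.Icc (-((N / 2 : ℕ) : ℤ)) ((N / 2 : ℕ) : ℤ)).filter
    (fun i => Even N → i ≠ 0)}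

/-- The label `-i`. -/
def Label.neg {N : ℕ} (i : Label N) : Label N :=
  ⟨-i.1, by
    have h := i.2
    simp only [Finset.mem_filter, Finset.mem_Icc] at h ⊢
    refine ⟨⟨by omega, by omega⟩, fun hN => ?_⟩
    have := h.2 hN
    omega⟩

/-- The sign of a label. (The label `0` does not occur in the symplectic case.) -/
def sgn {N : ℕ} (i : Label N) : ℂ := if i.1 < 0 then -1 else 1

/-- The sign `θ i j`: it is `1` in the orthogonal case and `sign i * sign j` in the
symplectic case. -/
def theta (s : Series) {N : ℕ} (i j : Label N) : ℂ :=
  match s with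
  | .orthogonal => 1
  | .symplectic => sgn i * sgn j

/-- The transposition `t`, the linear map with `(E i j)ᵗ = θ i j • E (-j) (-i)`. -/
def transp (s : Series) {N : ℕ} (A : Matrix (Label N) (Label N) ℂ) :
    Matrix (Label N) (Label N) ℂ :=
  Matrix.of fun i j => theta s i j * A j.neg i.neg

/-- The matrices `F i j = E i j - (E i j)ᵗ`. -/
def F (s : Series) {N : ℕ} (i j : Label N) : Matrix (Label N) (Label N) ℂ :=
  Matrix.single i j 1 - transp s (Matrix.single i j 1)

theorem Label.neg_neg {N : ℕ} (i : Label N) : i.neg.neg = i := by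
  simp [Label.neg]

theorem sgn_mul_self {N : ℕ} (i : Label N) : sgn i * sgn i = 1 := by
  unfold sgn; split_ifs <;> norm_num

theorem sgn_neg {N : ℕ} (hN : Even N) (i : Label N) : sgn i.neg = -sgn i := by
  have h := (Finset.mem_filter.1 i.2).2 hN
  unfold sgn
  by_cases h1 : i.1 < 0
  · have h2 : ¬ (i.neg.1 < 0) := by simp only [Label.neg]; omega
    simp [h1, h2]
  · have h2 : i.neg.1 < 0 := by simp only [Label.neg]; omega
    simp [h1, h2]

theorem theta_mul_theta (s : Series) {N : ℕ} (i j k : Label N) :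
    theta s i j * theta s j k = theta s i k := by
  cases s
  · simp [theta]
  · have := sgn_mul_self j
    simp only [theta]
    linear_combination sgn i * sgn k * this

theorem transp_mul (s : Series) {N : ℕ} (A B : Matrix (Label N) (Label N) ℂ) :
    transp s (A * B) = transp s B * transp s A := by
  ext i k
  simp only [transp, Matrix.of_apply, Matrix.mul_apply, Finset.mul_sum]
  refine Finset.sum_bij' (fun j _ => j.neg) (fun j _ => j.neg) (by simp) (by simp)
    (by simp [Label.neg_neg]) (by simp [Label.neg_neg]) ?_
  intro j _
  rw [Label.neg_neg, ← theta_mul_theta s i j.neg k]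
  ring

/-- The Lie algebra `𝔤_N`: the Lie subalgebra of `𝔤𝔩_N` of all matrices with `Aᵗ = -A`. It is `𝔰𝔬_N`
in the orthogonal case and, for `N` even, `𝔰𝔭_N` in the symplectic case. -/
def gN (s : Series) (N : ℕ) : LieSubalgebra ℂ (Matrix (Label N) (Label N) ℂ) where
  carrier := {A | transp s A = -A}
  add_mem' := by
    intro A B hA hB
    simp only [Set.mem_ofPred_eq] at *
    rw [neg_add, ← hA, ← hB]
    ext i j
    simp [transp, mul_add]
  zero_mem' := by
    ext i j
    simp [transp]
  smul_mem' := by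
    intro c A hA
    simp only [Set.mem_ofPred_eq] at *
    rw [← smul_neg, ← hA]
    ext i j
    simp [transp, mul_left_comm]
  lie_mem' := by
    intro A B hA hB
    change transp s A = -A at hA
    change transp s B = -B at hB
    change transp s ⁅A, B⁆ = -⁅A, B⁆
    have h : transp s (A * B - B * A) = transp s (A * B) - transp s (B * A) := by
      ext i j
      simp [transp, mul_sub]
    rw [Ring.lie_def, h, transp_mul, transp_mul, hA, hB]
    simp

/-- For `𝔰𝔬_N`, and for `𝔰𝔭_N` with `N` even, `𝔤_N` is the span of the matrices `F i j`. -/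
theorem gN_eq_span (s : Series) (N : ℕ) (h : s = .orthogonal ∨ Even N) :
    (gN s N).toSubmodule = Submodule.span ℂ (Set.range fun p : Label N × Label N => F s p.1 p.2) := by
  apply le_antisymm
  · intro A hA
    change transp s A = -A at hA
    have key : A = ∑ i, ∑ j, (A i j / 2) • F s i j := by
      have h1 : A = (1 / 2 : ℂ) • (A - transp s A) := by
        rw [hA, sub_neg_eq_add, ← two_smul ℂ A, smul_smul]; norm_num
      have h2 : A = ∑ i, ∑ j, A i j • Matrix.single i j (1 : ℂ) := by
        conv_lhs => rw [Matrix.matrix_eq_sum_single A]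
        simp [Matrix.smul_single]
      have h3 : transp s A = ∑ i, ∑ j, A i j • transp s (Matrix.single i j (1 : ℂ)) := by
        ext k l
        conv_lhs => rw [h2]
        simp only [transp, Matrix.of_apply, Matrix.sum_apply, Matrix.smul_apply, smul_eq_mul,
          Finset.mul_sum]
        refine Finset.sum_congr rfl fun i _ => Finset.sum_congr rfl fun j _ => by ring
      conv_lhs => rw [h1, h3]
      nth_rewrite 1 [h2]
      simp only [F, ← Finset.sum_sub_distrib, Finset.smul_sum]
      refine Finset.sum_congr rfl fun i _ => Finset.sum_congr rfl fun j _ => ?_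
      rw [← smul_sub, smul_smul]
      congr 1
      ring
    rw [key]
    exact Submodule.sum_mem _ fun i _ => Submodule.sum_mem _ fun j _ =>
      Submodule.smul_mem _ _ (Submodule.subset_span ⟨(i, j), rfl⟩)
  · rw [Submodule.span_le]
    rintro _ ⟨⟨i, j⟩, rfl⟩
    change transp s (F s i j) = -F s i j
    have hinv : ∀ k l : Label N, theta s k l * theta s l.neg k.neg = 1 := by
      intro k l
      cases s
      · simp [theta]
      · have hE : Even N := by simpa using h
        simp only [theta, sgn_neg hE]
        linear_combination sgn l * sgn l * sgn_mul_self k + sgn_mul_self l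
    ext k l
    simp only [F, transp, Matrix.of_apply, Matrix.sub_apply, Matrix.neg_apply, Label.neg_neg]
    linear_combination (-Matrix.single i j (1 : ℂ) k l) * hinv k l

/-- The invariant form `(X, Y) = ½ Tr (X Y)` on `𝔤_N`. -/
def halfTrace (s : Series) (N : ℕ) : LinearMap.BilinForm ℂ (gN s N) :=
  LinearMap.mk₂ ℂ
    (fun X Y => (1 / 2 : ℂ) *
      Matrix.trace ((X : Matrix (Label N) (Label N) ℂ) * (Y : Matrix (Label N) (Label N) ℂ)))
    (fun X X' Y => by simp [add_mul, mul_add])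
    (fun c X Y => by simp; ring)
    (fun X Y Y' => by simp [mul_add])
    (fun c X Y => by simp; ring)

/-! ### The Yangian in the `J`-presentation -/

section Presentation

variable (g : Type) [LieRing g] [LieAlgebra ℂ g]

/-- The generators `X` and `J(X)`, for `X` in the Lie algebra. -/
inductive Gen
  | x (X : g)
  | J (X : g)

variable {g}

/-- The generator `X` in the free associative unital `ℂ[ħ]`-algebra. -/
def gx (X : g) : FreeAlgebra ℂ[X] (Gen g) := FreeAlgebra.ι ℂ[X] (Gen.x X)

/-- The generator `J(X)` in the free associative unital `ℂ[ħ]`-algebra. -/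
def gJ (X : g) : FreeAlgebra ℂ[X] (Gen g) := FreeAlgebra.ι ℂ[X] (Gen.J X)

/-- `{x₁, x₂, x₃} = (1/24) ∑_σ x_σ(1) x_σ(2) x_σ(3)`, with `σ` running over the permutations. -/
def sym3 (x₁ x₂ x₃ : FreeAlgebra ℂ[X] (Gen g)) : FreeAlgebra ℂ[X] (Gen g) :=
  (1 / 24 : ℂ) • ∑ σ : Equiv.Perm (Fin 3),
    (![x₁, x₂, x₃] (σ 0) * ![x₁, x₂, x₃] (σ 1) * ![x₁, x₂, x₃] (σ 2))

/-- A basis of the Lie algebra that is orthonormal for the bilinear form `B`. -/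
def IsOrthonormalBasis {L : Type} (B : LinearMap.BilinForm ℂ g) (b : Module.Basis L ℂ g) : Prop :=
  (∀ l, B (b l) (b l) = 1) ∧ ∀ l m, l ≠ m → B (b l) (b m) = 0

/-- `α_λμν = ([X₁, X_λ], [[X₂, X_μ], [X₃, X_ν]])`. -/
def alphaCoeff {L : Type} (B : LinearMap.BilinForm ℂ g) (b : L → g) (X₁ X₂ X₃ : g)
    (l m n : L) : ℂ :=
  B ⁅X₁, b l⁆ ⁅⁅X₂, b m⁆, ⁅X₃, b n⁆⁆

/-- `β_λμν = ([X₁, X_λ], [[X₂, X_μ], [[X₃, X₄], X_ν]]) + ([X₃, X_λ], [[X₄, X_μ], [[X₁, X₂], X_ν]])`. -/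
def betaCoeff {L : Type} (B : LinearMap.BilinForm ℂ g) (b : L → g) (X₁ X₂ X₃ X₄ : g)
    (l m n : L) : ℂ :=
  B ⁅X₁, b l⁆ ⁅⁅X₂, b m⁆, ⁅⁅X₃, X₄⁆, b n⁆⁆ + B ⁅X₃, b l⁆ ⁅⁅X₄, b m⁆, ⁅⁅X₁, X₂⁆, b n⁆⁆

variable (g) in
/-- The Lie algebra is isomorphic to `𝔰𝔩₂`. -/
def IsSl2 : Prop :=
  Nonempty (g ≃ₗ⁅ℂ⁆ LieAlgebra.SpecialLinear.sl (Fin 2) ℂ)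

variable (g) in
/-- The Lie algebra has an ideal isomorphic to `𝔰𝔩₂`. For a simple Lie algebra this says that it
is isomorphic to `𝔰𝔩₂`; for a semisimple one it says that one of its simple factors is. -/
def HasSl2Factor : Prop :=
  ∃ I : LieIdeal ℂ g, Nonempty (I ≃ₗ⁅ℂ⁆ LieAlgebra.SpecialLinear.sl (Fin 2) ℂ)

/-- The defining relations of the Yangian `Y_ħ(g)`, where `ħ` is the polynomial variable.
The cubic relation is imposed unless `g` is `𝔰𝔩₂`. The quartic relation is imposed if `g` is
`𝔰𝔩₂` and, for a semisimple `g` which is not simple, as soon as a simple factor is `𝔰𝔩₂`. -/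
inductive Rel {L : Type} [Fintype L] (B : LinearMap.BilinForm ℂ g) (b : L → g) :
    FreeAlgebra ℂ[X] (Gen g) → FreeAlgebra ℂ[X] (Gen g) → Prop
  | x_linear (a c : ℂ) (X₁ X₂ : g) :
      Rel B b (gx (a • X₁ + c • X₂)) (a • gx X₁ + c • gx X₂)
  | x_lie (X₁ X₂ : g) :
      Rel B b (gx X₁ * gx X₂ - gx X₂ * gx X₁) (gx ⁅X₁, X₂⁆)
  | J_lie (X₁ X₂ : g) :
      Rel B b ⁅gx X₁, gJ X₂⁆ (gJ ⁅X₁, X₂⁆)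
  | J_linear (a c : ℂ) (X₁ X₂ : g) :
      Rel B b (gJ (a • X₁ + c • X₂)) (a • gJ X₁ + c • gJ X₂)
  | cubic (h : ¬ IsSl2 g) (X₁ X₂ X₃ : g) :
      Rel B b (⁅gJ X₁, ⁅gJ X₂, gx X₃⁆⁆ - ⁅gx X₁, ⁅gJ X₂, gJ X₃⁆⁆)
        ((Polynomial.X ^ 2 : ℂ[X]) • ∑ l, ∑ m, ∑ n,
          alphaCoeff B b X₁ X₂ X₃ l m n • sym3 (gx (b l)) (gx (b m)) (gx (b n)))
  | quartic (h : HasSl2Factor g) (X₁ X₂ X₃ X₄ : g) :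
      Rel B b (⁅⁅gJ X₁, gJ X₂⁆, ⁅gx X₃, gJ X₄⁆⁆ + ⁅⁅gJ X₃, gJ X₄⁆, ⁅gx X₁, gJ X₂⁆⁆)
        ((Polynomial.X ^ 2 : ℂ[X]) • ∑ l, ∑ m, ∑ n,
          betaCoeff B b X₁ X₂ X₃ X₄ l m n • sym3 (gx (b l)) (gx (b m)) (gJ (b n)))

/-- The Yangian `Y_ħ(g)`, a unital associative algebra over `ℂ[ħ]`. -/
abbrev YangianH {L : Type} [Fintype L] (B : LinearMap.BilinForm ℂ g) (b : L → g) : Type :=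
  RingQuot (Rel B b)

/-- The relation `ħ = ζ`. -/
inductive SpecRel {L : Type} [Fintype L] (B : LinearMap.BilinForm ℂ g) (b : L → g) (ζ : ℂ) :
    YangianH B b → YangianH B b → Prop
  | spec : SpecRel B b ζ (algebraMap ℂ[X] (YangianH B b) Polynomial.X)
      (algebraMap ℂ (YangianH B b) ζ)

/-- The Yangian `Y_ζ(g) = Y_ħ(g) / (ħ - ζ) Y_ħ(g)`, a unital associative algebra over `ℂ`.
Since `ħ` and `ζ` are central, the two-sided ideal generated by `ħ - ζ` is
`(ħ - ζ) Y_ħ(g)`. -/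
abbrev Yangian {L : Type} [Fintype L] (B : LinearMap.BilinForm ℂ g) (b : L → g) (ζ : ℂ) : Type :=
  RingQuot (SpecRel B b ζ)

/-- The quotient map from the free algebra to `Y_ζ(g)`. -/
def toYangian {L : Type} [Fintype L] (B : LinearMap.BilinForm ℂ g) (b : L → g) (ζ : ℂ) :
    FreeAlgebra ℂ[X] (Gen g) →ₐ[ℂ] Yangian B b ζ :=
  (RingQuot.mkAlgHom ℂ (SpecRel B b ζ)).comp (RingQuot.mkAlgHom ℂ (Rel B b))

/-- The generator `X` of `Y_ζ(g)`. -/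
def Yangian.x {L : Type} [Fintype L] (B : LinearMap.BilinForm ℂ g) (b : L → g) (ζ : ℂ) (X : g) :
    Yangian B b ζ :=
  toYangian B b ζ (gx X)

/-- The generator `J(X)` of `Y_ζ(g)`. -/
def Yangian.J {L : Type} [Fintype L] (B : LinearMap.BilinForm ℂ g) (b : L → g) (ζ : ℂ) (X : g) :
    Yangian B b ζ :=
  toYangian B b ζ (gJ X)

end Presentation

/-- The natural representation of `𝔤_N` on `ℂ^N`: a matrix acts on column vectors. -/
def naturalRep (s : Series) (N : ℕ) : gN s N →ₗ⁅ℂ⁆ Module.End ℂ (Label N → ℂ) :=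
  (lieEquivMatrix' (R := ℂ) (n := Label N)).symm.toLieHom.comp (gN s N).incl

end DrinfeldYangian

end

open scoped Polynomial

/-! With `J` acting by zero, the linear and Lie relations hold trivially, and both sides of the
quartic relation contain a factor `J`. What remains is that the right-hand side of the cubic
relation acts by zero on `ℂ^N`.

Its coefficients are traces `tr([X₁,X_λ][X₂,X_μ][X₃,X_ν])`. Orthonormality amounts to `∑ tr(A X_λ)
X_λ = A - Aᵗ`. Invariance of this tensor moves the three commutators from the trace to the product,
and `sum_trace_mul_mul` then evaluates the unsymmetrized sum in closed form
(`sum_trace_comm_comm_comm_eq`). Since the trace of a triple product is alternating on `𝔤_N`,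
symmetrizing the product antisymmetrizes this closed form in `X₁, X₂, X₃`, and its terms cancel in
pairs. The cancellation does not depend on the coefficients, so no rank is exceptional. -/

namespace DrinfeldYangian

attribute [local instance 100] LieRing.ofAssociativeRing

/-! ### The transposition and the trace. -/

section Transposition

variable {s : Series} {N : ℕ}

/-- The sign of the bilinear form on `ℂ^N` which `𝔤_N` preserves: `1` if it is symmetric and `-1`
if it is alternating. -/
def formSign : Series → ℂ
  | .orthogonal => 1
  | .symplectic => -1

theorem formSign_mul_self (s : Series) : formSign s * formSign s = 1 := by
  cases s <;> simp [formSign]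

/-- In the symplectic case evenness of `N` excludes the label `0`, whose sign negation would not
change. -/
theorem theta_neg_left (h : s = .orthogonal ∨ Even N) (i j : Label N) :
    theta s i.neg j = formSign s * theta s i j := by
  cases s
  · simp [theta, formSign]
  · have hE : Even N := by simpa using h
    simp [theta, formSign, sgn_neg hE]

theorem theta_self (i : Label N) : theta s i i = 1 := by
  cases s
  · rfl
  · exact sgn_mul_self i

theorem theta_mul_theta_neg (h : s = .orthogonal ∨ Even N) (i j : Label N) :
    theta s i j * theta s j.neg i.neg = 1 := by
  cases s
  · simp [theta]
  · have hE : Even N := by simpa using h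
    simp only [theta, sgn_neg hE]
    linear_combination sgn j * sgn j * sgn_mul_self i + sgn_mul_self j

theorem transp_transp (h : s = .orthogonal ∨ Even N) (A : Matrix (Label N) (Label N) ℂ) :
    transp s (transp s A) = A := by
  ext i j
  simp only [transp, Matrix.of_apply, Label.neg_neg]
  linear_combination A i j * theta_mul_theta_neg h i j

theorem transp_sub (A B : Matrix (Label N) (Label N) ℂ) :
    transp s (A - B) = transp s A - transp s B := by
  ext i j
  simp [transp, mul_sub]

theorem transp_one : transp s (1 : Matrix (Label N) (Label N) ℂ) = 1 := by
  ext i j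
  simp only [transp, Matrix.of_apply, Matrix.one_apply]
  by_cases hij : i = j
  · subst hij; simp [theta_self]
  · have : j.neg ≠ i.neg := fun h => hij (by rw [← Label.neg_neg i, ← h, Label.neg_neg])
    simp [hij, this]

theorem trace_transp (A : Matrix (Label N) (Label N) ℂ) : (transp s A).trace = A.trace := by
  simp only [Matrix.trace, Matrix.diag_apply, transp, Matrix.of_apply, theta_self, one_mul]
  exact Finset.sum_bij' (fun j _ => j.neg) (fun j _ => j.neg) (by simp) (by simp)
    (by simp [Label.neg_neg]) (by simp [Label.neg_neg]) (fun _ _ => rfl)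

theorem transp_coe (X : gN s N) :
    transp s (X : Matrix (Label N) (Label N) ℂ) = -(X : Matrix (Label N) (Label N) ℂ) :=
  X.2

theorem trace_eq_zero_of_transp_eq_neg {X : Matrix (Label N) (Label N) ℂ}
    (hX : transp s X = -X) : X.trace = 0 := by
  have h := trace_transp (s := s) X
  rw [hX, Matrix.trace_neg] at h
  linear_combination (-1 / 2 : ℂ) * h

theorem transp_comm {X Y : Matrix (Label N) (Label N) ℂ} (hX : transp s X = -X)
    (hY : transp s Y = -Y) : transp s (X * Y - Y * X) = -(X * Y - Y * X) := by
  simp only [transp_sub, transp_mul, hX, hY]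
  noncomm_ring

/-- Transposition preserves the trace, reverses the product and contributes `(-1)³`. With cyclicity
this makes `tr(XYZ)` an alternating form on `𝔤_N`. -/
theorem trace_mul_mul_swap {X Y Z : Matrix (Label N) (Label N) ℂ} (hX : transp s X = -X)
    (hY : transp s Y = -Y) (hZ : transp s Z = -Z) :
    (Y * X * Z).trace = -(X * Y * Z).trace := by
  rw [← trace_transp (s := s), transp_mul, transp_mul, hX, hY, hZ, ← Matrix.trace_neg,
    Matrix.trace_mul_comm]
  congr 1
  noncomm_ring

end Transposition

/-! ### Contractions with the Casimir tensor. -/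

section Casimir

variable {s : Series} {N : ℕ} {L : Type} [Fintype L]

/-- A finite family of matrices of `𝔤_N` for which `∑ X_l ⊗ X_l` is dual to half the trace form. -/
structure IsCasimirFamily (s : Series) (c : L → Matrix (Label N) (Label N) ℂ) : Prop where
  transp_eq : ∀ l, transp s (c l) = -c l
  sum_trace_smul : ∀ A, ∑ l, (A * c l).trace • c l = A - transp s A

/-- The matrix `A - Aᵗ` lies in `𝔤_N`. Its coordinate along `b l` is `½ tr((A - Aᵗ) b_l)`, and the
two halves agree because transposing turns `tr(Aᵗ b_l)` into `-tr(A b_l)`. -/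
theorem IsOrthonormalBasis.isCasimirFamily (h : s = .orthogonal ∨ Even N)
    {b : Module.Basis L ℂ (gN s N)} (hb : IsOrthonormalBasis (halfTrace s N) b) :
    IsCasimirFamily s (fun l => (b l : Matrix (Label N) (Label N) ℂ)) := by
  classical
  refine ⟨fun l => transp_coe (b l), fun A => ?_⟩
  have hY : A - transp s A ∈ gN s N := by
    change transp s (A - transp s A) = -(A - transp s A)
    rw [transp_sub, transp_transp h, neg_sub]
  have hrepr : ∀ l, b.repr ⟨_, hY⟩ l = (A * (b l : Matrix (Label N) (Label N) ℂ)).trace := by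
    intro l
    have h1 : halfTrace s N ⟨_, hY⟩ (b l) = b.repr ⟨_, hY⟩ l := by
      conv_lhs => rw [← b.sum_repr ⟨_, hY⟩]
      rw [map_sum, LinearMap.sum_apply, Finset.sum_eq_single l]
      · simp [hb.1 l]
      · intro m _ hm
        simp [hb.2 m l hm]
      · simp
    have h2 : (transp s A * (b l : Matrix (Label N) (Label N) ℂ)).trace =
        -(A * (b l : Matrix (Label N) (Label N) ℂ)).trace := by
      rw [← trace_transp (s := s), transp_mul, transp_transp h, transp_coe, neg_mul,
        Matrix.trace_neg, Matrix.trace_mul_comm]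
    rw [← h1]
    change (1 / 2 : ℂ) * ((A - transp s A) * (b l : Matrix (Label N) (Label N) ℂ)).trace = _
    rw [sub_mul, Matrix.trace_sub, h2]
    ring
  have h3 := congrArg (Subtype.val) (b.sum_repr ⟨_, hY⟩)
  simpa [hrepr] using h3

variable {c : L → Matrix (Label N) (Label N) ℂ}

theorem IsCasimirFamily.sum_mul_mul (hc : IsCasimirFamily s c) (h : s = .orthogonal ∨ Even N)
    (A : Matrix (Label N) (Label N) ℂ) :
    ∑ l, c l * A * c l = A.trace • 1 - formSign s • transp s A := by
  -- Taking `A` to be a matrix unit yields the entries of the Casimir tensor: the flip minus its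
  -- partial transpose. These two parts produce the trace term and the transpose term.
  have key : ∀ i j k m : Label N, ∑ l, c l i j * c l k m =
      (if j = k ∧ i = m then 1 else 0) - theta s k m * (if j = m.neg ∧ i = k.neg then 1 else 0) := by
    intro i j k m
    have := congrFun (congrFun (hc.sum_trace_smul (Matrix.single j i 1)) k) m
    simpa [Matrix.sum_apply, Matrix.trace_single_mul, transp, Matrix.single_apply] using this
  ext i m
  have h1 : (∑ l, c l * A * c l) i m = ∑ k, ∑ j, A j k * ∑ l, c l i j * c l k m := by
    simp only [Matrix.sum_apply, Matrix.mul_apply, Finset.sum_mul, Finset.mul_sum]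
    rw [Finset.sum_comm]
    refine Finset.sum_congr rfl fun k _ => ?_
    rw [Finset.sum_comm]
    exact Finset.sum_congr rfl fun j _ => Finset.sum_congr rfl fun l _ => by ring
  have h2 : ∀ k : Label N, i = k.neg ↔ k = i.neg := fun k =>
    ⟨fun e => by rw [e, Label.neg_neg], fun e => by rw [e, Label.neg_neg]⟩
  rw [h1]
  simp only [key, h2, mul_sub, Finset.sum_sub_distrib, ite_and, mul_ite, mul_one, mul_zero,
    Finset.sum_ite_eq', Finset.mem_univ, if_true]
  simp only [Matrix.sub_apply, Matrix.smul_apply, Matrix.one_apply, smul_eq_mul, transp,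
    Matrix.of_apply, theta_neg_left h, Matrix.trace, Matrix.diag_apply]
  split_ifs <;> simp <;> ring

theorem IsCasimirFamily.sum_trace_smul_mul (hc : IsCasimirFamily s c)
    (A U V : Matrix (Label N) (Label N) ℂ) :
    ∑ l, (c l * A).trace • (U * c l * V) = U * (A - transp s A) * V := by
  rw [← hc.sum_trace_smul, Finset.mul_sum, Finset.sum_mul]
  exact Finset.sum_congr rfl fun l _ => by
    rw [Matrix.trace_mul_comm, mul_smul_comm, smul_mul_assoc]

/-- This is the `𝔤_N`-invariance of the Casimir tensor: `ad X` passes from one leg to the other with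
a sign, because `A ↦ A - Aᵗ` commutes with `ad X`. -/
theorem IsCasimirFamily.sum_trace_comm_smul (hc : IsCasimirFamily s c)
    {X : Matrix (Label N) (Label N) ℂ} (hX : transp s X = -X)
    (A U V : Matrix (Label N) (Label N) ℂ) :
    ∑ l, ((X * c l - c l * X) * A).trace • (U * c l * V) =
      ∑ l, (c l * A).trace • (U * (c l * X - X * c l) * V) := by
  have h1 : ∀ l, ((X * c l - c l * X) * A).trace = (c l * (A * X - X * A)).trace := by
    intro l
    simp only [sub_mul, mul_sub, Matrix.trace_sub]
    congr 1
    · rw [mul_assoc, Matrix.trace_mul_comm, mul_assoc]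
    · rw [mul_assoc]
  have h2 : ∀ l, U * (c l * X - X * c l) * V = U * c l * (X * V) - (U * X) * c l * V := by
    intro l; noncomm_ring
  simp only [h1, h2, smul_sub, Finset.sum_sub_distrib, hc.sum_trace_smul_mul, transp_sub,
    transp_mul, hX]
  noncomm_ring

/-- The contraction of the invariant three-form of `𝔤_N` with `a ⊗ b ⊗ c ↦ a P b Q c`. -/
theorem IsCasimirFamily.sum_trace_mul_mul (hc : IsCasimirFamily s c)
    (h : s = .orthogonal ∨ Even N) (P Q : Matrix (Label N) (Label N) ℂ) :
    ∑ l, ∑ m, ∑ n, (c l * c m * c n).trace • (c l * P * c m * Q * c n) =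
      Q * P - Q * transp s P - transp s P * transp s Q - transp s Q * P
        + (formSign s * Q.trace) • transp s P + (formSign s * P.trace) • transp s Q
        - (P.trace * Q.trace) • 1 + (formSign s * (transp s P * Q).trace) • 1 := by
  -- Summing over `l` replaces the first factor by `c_m c_n - (c_m c_n)ᵗ = [c_m, c_n]`, so that
  -- `c_m` then encloses a single matrix in each term and `sum_mul_mul` applies.
  have h1 : ∀ m n, ∑ l, (c l * c m * c n).trace • (c l * P * c m * Q * c n) =
      c m * (c n * P) * c m * Q * c n - c n * (c m * P * c m) * Q * c n := by
    intro m n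
    have := hc.sum_trace_smul_mul (c m * c n) 1 (P * c m * Q * c n)
    simp only [one_mul, transp_mul, hc.transp_eq, mul_assoc] at this
    simp only [mul_assoc, this]
    noncomm_ring
  have h2 : ∀ n, ∑ m, (c m * (c n * P) * c m * Q * c n - c n * (c m * P * c m) * Q * c n) =
      (c n * P).trace • (Q * c n * 1) + formSign s • (transp s P * (c n * Q * c n))
        - (P.trace • (c n * Q * c n) - formSign s • (c n * (transp s P * Q) * c n)) := by
    intro n
    rw [Finset.sum_sub_distrib]
    simp only [← Finset.sum_mul, ← Finset.mul_sum, hc.sum_mul_mul h, transp_mul, hc.transp_eq]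
    simp only [sub_mul, mul_sub, smul_mul_assoc, mul_smul_comm, one_mul, mul_one, mul_neg,
      neg_mul, mul_assoc, smul_neg]
    module
  rw [show (∑ l, ∑ m, ∑ n, (c l * c m * c n).trace • (c l * P * c m * Q * c n)) =
      ∑ n, ∑ m, ∑ l, (c l * c m * c n).trace • (c l * P * c m * Q * c n) by
    rw [Finset.sum_comm_cycle, Finset.sum_congr rfl]
    intro n _
    rw [Finset.sum_comm]]
  simp only [h1, h2, Finset.sum_sub_distrib, Finset.sum_add_distrib, ← Finset.smul_sum,
    ← Finset.mul_sum, hc.sum_mul_mul h, hc.sum_trace_smul_mul, transp_mul, transp_transp h]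
  have hk := formSign_mul_self s
  simp only [mul_sub, mul_smul_comm, smul_sub, smul_smul, mul_one, hk, one_smul]
  module

/-- The contraction of the invariant three-form with `a ⊗ b ⊗ c ↦ a b c`, after `ad X`, `ad Y` and
`ad Z` have been applied to its arguments. -/
theorem IsCasimirFamily.sum_trace_comm_comm_comm (hc : IsCasimirFamily s c)
    {X Y Z : Matrix (Label N) (Label N) ℂ}
    (hX : transp s X = -X) (hY : transp s Y = -Y) (hZ : transp s Z = -Z) :
    ∑ l, ∑ m, ∑ n, ((X * c l - c l * X) * (Y * c m - c m * Y) * (Z * c n - c n * Z)).trace •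
        (c l * c m * c n) =
      ∑ l, ∑ m, ∑ n, (c l * c m * c n).trace •
        ((c l * X - X * c l) * (c m * Y - Y * c m) * (c n * Z - Z * c n)) := by
  -- At each stage cyclicity of the trace brings the next commutator to the front, where
  -- `sum_trace_comm_smul` moves it onto the product.
  calc _ = ∑ m, ∑ n, ∑ l, ((X * c l - c l * X) * ((Y * c m - c m * Y) * (Z * c n - c n * Z))).trace •
        (1 * c l * (c m * c n)) := by
        rw [Finset.sum_comm]
        refine Finset.sum_congr rfl fun m _ => ?_
        rw [Finset.sum_comm]
        simp only [one_mul, mul_assoc]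
    _ = ∑ l, ∑ n, ∑ m, ((Y * c m - c m * Y) * ((Z * c n - c n * Z) * c l)).trace •
        ((c l * X - X * c l) * c m * c n) := by
        simp only [hc.sum_trace_comm_smul hX]
        simp only [one_mul]
        rw [Finset.sum_comm_cycle]
        refine Finset.sum_congr rfl fun l _ => ?_
        rw [Finset.sum_comm]
        refine Finset.sum_congr rfl fun n _ => Finset.sum_congr rfl fun m _ => ?_
        rw [Matrix.trace_mul_comm, mul_assoc, mul_assoc]
    _ = ∑ l, ∑ m, ∑ n, ((Z * c n - c n * Z) * (c l * c m)).trace •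
        ((c l * X - X * c l) * (c m * Y - Y * c m) * c n * 1) := by
        simp only [hc.sum_trace_comm_smul hY]
        refine Finset.sum_congr rfl fun l _ => ?_
        rw [Finset.sum_comm]
        refine Finset.sum_congr rfl fun m _ => Finset.sum_congr rfl fun n _ => ?_
        rw [Matrix.trace_mul_comm (c m), mul_assoc, mul_one]
    _ = _ := by
        simp only [hc.sum_trace_comm_smul hZ]
        simp only [mul_one]
        refine Finset.sum_congr rfl fun l _ => Finset.sum_congr rfl fun m _ =>
          Finset.sum_congr rfl fun n _ => ?_
        rw [Matrix.trace_mul_comm]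

/-- The value of `IsCasimirFamily.sum_trace_comm_comm_comm`, in closed form. -/
theorem IsCasimirFamily.sum_trace_comm_comm_comm_eq (hc : IsCasimirFamily s c)
    (h : s = .orthogonal ∨ Even N) {X Y Z : Matrix (Label N) (Label N) ℂ}
    (hX : transp s X = -X) (hY : transp s Y = -Y) (hZ : transp s Z = -Z) :
    ∑ l, ∑ m, ∑ n, ((X * c l - c l * X) * (Y * c m - c m * Y) * (Z * c n - c n * Z)).trace •
        (c l * c m * c n) =
      (6 - formSign s * Fintype.card (Label N)) • (Y * X * Z - X * Z * Y)
        + (2 : ℂ) • (Z * X * Y - Y * Z * X)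
        + (Fintype.card (Label N) - 4 * formSign s) •
          ((X * Y).trace • Z - (Y * Z).trace • X) := by
  -- The three commutators expand into eight monomials `c_l P c_m Q c_n`, with `X` possibly outside
  -- on the left and `Z` on the right.
  have e : ∀ (t : ℂ) (l m n : L),
      t • ((c l * X - X * c l) * (c m * Y - Y * c m) * (c n * Z - Z * c n)) =
      (t • (c l * X * c m * Y * c n)) * Z - t • (c l * X * c m * (Y * Z) * c n)
      - (t • (c l * (X * Y) * c m * 1 * c n)) * Z + t • (c l * (X * Y) * c m * Z * c n)
      - X * (t • (c l * 1 * c m * Y * c n)) * Z + X * (t • (c l * 1 * c m * (Y * Z) * c n))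
      + X * (t • (c l * Y * c m * 1 * c n)) * Z - X * (t • (c l * Y * c m * Z * c n)) := by
    intro t l m n
    simp only [mul_smul_comm, smul_mul_assoc, ← smul_sub, ← smul_add]
    congr 1
    noncomm_ring
  rw [hc.sum_trace_comm_comm_comm hX hY hZ]
  simp only [e, Finset.sum_add_distrib, Finset.sum_sub_distrib,
    ← Finset.sum_mul, ← Finset.mul_sum, hc.sum_trace_mul_mul h]
  simp only [transp_mul, hX, hY, hZ, transp_one, trace_eq_zero_of_transp_eq_neg hX,
    trace_eq_zero_of_transp_eq_neg hY, trace_eq_zero_of_transp_eq_neg hZ, Matrix.trace_one,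
    mul_zero, zero_mul, zero_smul, add_zero, sub_zero, mul_one, one_mul, neg_mul, mul_neg,
    neg_neg, Matrix.trace_neg, smul_neg, mul_add, add_mul, mul_sub, sub_mul, smul_mul_assoc,
    mul_smul_comm, mul_assoc]
  -- The traces are brought to a common form; the multiples of the identity by `tr(XYZ)` and
  -- `tr(YXZ)` then cancel.
  rw [Matrix.trace_mul_comm Y X, ← mul_assoc Y X Z, trace_mul_mul_swap hX hY hZ, mul_assoc X Y Z]
  module

/-- Renaming the summation indices turns each reordered product into the unsymmetrized sum at
permuted `X, Y, Z`, with the sign of the permutation. In the alternating sum of the closed form,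
`YXZ` and `XZY` are both odd orderings and `ZXY` and `YZX` both even, so each difference dies; the
remaining terms die by the symmetry of `tr(XY)`. -/
theorem IsCasimirFamily.sum_trace_smul_symmetrization (hc : IsCasimirFamily s c)
    (h : s = .orthogonal ∨ Even N) {X Y Z : Matrix (Label N) (Label N) ℂ}
    (hX : transp s X = -X) (hY : transp s Y = -Y) (hZ : transp s Z = -Z) :
    ∑ l, ∑ m, ∑ n, ((X * c l - c l * X) * (Y * c m - c m * Y) * (Z * c n - c n * Z)).trace •
        (c l * c m * c n + c l * c n * c m + c m * c l * c n + c m * c n * c l + c n * c l * c m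
          + c n * c m * c l) = 0 := by
  have hadX := fun l => transp_comm hX (hc.transp_eq l)
  have hadY := fun l => transp_comm hY (hc.transp_eq l)
  have hadZ := fun l => transp_comm hZ (hc.transp_eq l)
  have hcyc : ∀ l m n,
      ((X * c l - c l * X) * (Y * c m - c m * Y) * (Z * c n - c n * Z)).trace =
      ((Y * c m - c m * Y) * (Z * c n - c n * Z) * (X * c l - c l * X)).trace := fun l m n => by
    rw [mul_assoc, Matrix.trace_mul_comm]
  have hcyc' : ∀ l m n,
      ((X * c l - c l * X) * (Y * c m - c m * Y) * (Z * c n - c n * Z)).trace =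
      ((Z * c n - c n * Z) * (X * c l - c l * X) * (Y * c m - c m * Y)).trace := fun l m n => by
    rw [Matrix.trace_mul_comm, mul_assoc]
  have hYXZ : ∀ l m n,
      ((X * c l - c l * X) * (Y * c m - c m * Y) * (Z * c n - c n * Z)).trace =
      -((Y * c m - c m * Y) * (X * c l - c l * X) * (Z * c n - c n * Z)).trace := fun l m n =>
    trace_mul_mul_swap (hadY m) (hadX l) (hadZ n)
  have hXZY : ∀ l m n,
      ((X * c l - c l * X) * (Y * c m - c m * Y) * (Z * c n - c n * Z)).trace =
      -((X * c l - c l * X) * (Z * c n - c n * Z) * (Y * c m - c m * Y)).trace := fun l m n => by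
    rw [hcyc', trace_mul_mul_swap (hadX l) (hadZ n) (hadY m)]
  have hZYX : ∀ l m n,
      ((X * c l - c l * X) * (Y * c m - c m * Y) * (Z * c n - c n * Z)).trace =
      -((Z * c n - c n * Z) * (Y * c m - c m * Y) * (X * c l - c l * X)).trace := fun l m n => by
    rw [hcyc, trace_mul_mul_swap (hadZ n) (hadY m) (hadX l)]
  -- `G` is kept opaque, so that the sums at permuted arguments are unfolded only where `hG` is
  -- used.
  obtain ⟨G, hG⟩ : ∃ G : Matrix (Label N) (Label N) ℂ → Matrix (Label N) (Label N) ℂ →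
      Matrix (Label N) (Label N) ℂ → Matrix (Label N) (Label N) ℂ, ∀ U V W, G U V W =
      ∑ l, ∑ m, ∑ n, ((U * c l - c l * U) * (V * c m - c m * V) * (W * c n - c n * W)).trace •
        (c l * c m * c n) := ⟨_, fun _ _ _ => rfl⟩
  have fXZY : ∑ l, ∑ m, ∑ n, ((X * c l - c l * X) * (Y * c m - c m * Y) *
      (Z * c n - c n * Z)).trace • (c l * c n * c m) = -G X Z Y := by
    simp only [hXZY, neg_smul, Finset.sum_neg_distrib]
    rw [hG]
    exact congrArg _ (Finset.sum_congr rfl fun l _ => Finset.sum_comm)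
  have fYXZ : ∑ l, ∑ m, ∑ n, ((X * c l - c l * X) * (Y * c m - c m * Y) *
      (Z * c n - c n * Z)).trace • (c m * c l * c n) = -G Y X Z := by
    simp only [hYXZ, neg_smul, Finset.sum_neg_distrib]
    rw [hG]
    exact congrArg _ Finset.sum_comm
  have fYZX : ∑ l, ∑ m, ∑ n, ((X * c l - c l * X) * (Y * c m - c m * Y) *
      (Z * c n - c n * Z)).trace • (c m * c n * c l) = G Y Z X := by
    simp only [hcyc]
    rw [hG, Finset.sum_comm]
    exact Finset.sum_congr rfl fun l _ => Finset.sum_comm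
  have fZXY : ∑ l, ∑ m, ∑ n, ((X * c l - c l * X) * (Y * c m - c m * Y) *
      (Z * c n - c n * Z)).trace • (c n * c l * c m) = G Z X Y := by
    simp only [hcyc']
    rw [hG, Finset.sum_comm_cycle]
  have fZYX : ∑ l, ∑ m, ∑ n, ((X * c l - c l * X) * (Y * c m - c m * Y) *
      (Z * c n - c n * Z)).trace • (c n * c m * c l) = -G Z Y X := by
    simp only [hZYX, neg_smul, Finset.sum_neg_distrib]
    rw [hG, Finset.sum_comm_cycle]
    exact congrArg _ (Finset.sum_congr rfl fun l _ => Finset.sum_comm)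
  simp only [smul_add, Finset.sum_add_distrib, fXZY, fYXZ, fYZX, fZXY, fZYX,
    hG, hc.sum_trace_comm_comm_comm_eq h, hX, hY, hZ]
  rw [Matrix.trace_mul_comm Y X, Matrix.trace_mul_comm Z X, Matrix.trace_mul_comm Z Y]
  module

end Casimir

/-! ### Homomorphisms out of the specialized Yangian. -/

section Evaluation

variable {g A : Type} [Ring A] [Algebra ℂ A]

/-- An assignment of the generators extends to the free `ℂ[ħ]`-algebra, with `ħ` acting by `ζ`. -/
theorem exists_algHom_freeAlgebra (ζ : ℂ) (f : Gen g → A) :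
    ∃ φ : FreeAlgebra ℂ[X] (Gen g) →ₐ[ℂ] A, (∀ x, φ (FreeAlgebra.ι ℂ[X] x) = f x) ∧
      ∀ p : ℂ[X], φ (algebraMap ℂ[X] _ p) = algebraMap ℂ A (p.eval ζ) := by
  -- Evaluation at `ζ` makes `A` a `ℂ[ħ]`-algebra, over which the free algebra has its universal
  -- property.
  let _ : Algebra ℂ[X] A := RingHom.toAlgebra' ((algebraMap ℂ A).comp (Polynomial.evalRingHom ζ))
    fun p x => Algebra.commutes _ _
  have hmap : ∀ p : ℂ[X], algebraMap ℂ[X] A p = algebraMap ℂ A (p.eval ζ) := fun _ => rfl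
  have : IsScalarTower ℂ ℂ[X] A := IsScalarTower.of_algebraMap_eq fun z => by
    rw [hmap, Polynomial.algebraMap_eq, Polynomial.eval_C]
  refine ⟨(FreeAlgebra.lift ℂ[X] f).restrictScalars ℂ, fun x => ?_, fun p => ?_⟩
  · simp
  · simp [hmap]

theorem sum_perm_fin_three {A : Type} [Ring A] (x y z : A) :
    ∑ σ : Equiv.Perm (Fin 3), (![x, y, z] (σ 0) * ![x, y, z] (σ 1) * ![x, y, z] (σ 2)) =
      x * y * z + x * z * y + y * x * z + y * z * x + z * x * y + z * y * x := by
  have huniv : (Finset.univ : Finset (Equiv.Perm (Fin 3))) =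
      {1, Equiv.swap 1 2, Equiv.swap 0 1, Equiv.swap 0 1 * Equiv.swap 1 2,
        Equiv.swap 0 2 * Equiv.swap 1 2, Equiv.swap 0 2} := by decide
  rw [huniv]
  repeat rw [Finset.sum_insert (by decide)]
  rw [Finset.sum_singleton]
  simp only [← add_assoc]
  rfl

theorem map_sym3 (φ : FreeAlgebra ℂ[X] (Gen g) →ₐ[ℂ] A) (x y z : FreeAlgebra ℂ[X] (Gen g)) :
    φ (sym3 x y z) = (1 / 24 : ℂ) • (φ x * φ y * φ z + φ x * φ z * φ y + φ y * φ x * φ z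
      + φ y * φ z * φ x + φ z * φ x * φ y + φ z * φ y * φ x) := by
  rw [sym3, sum_perm_fin_three, map_smul]
  simp only [map_add, map_mul]

/-- A Lie algebra homomorphism which kills the right-hand side of the cubic relation extends to
the Yangian, with `J` acting by zero. -/
theorem exists_algHom_yangian {L : Type} [Fintype L] [LieRing g] [LieAlgebra ℂ g]
    (B : LinearMap.BilinForm ℂ g) (b : L → g) (ζ : ℂ)
    (f : g →ₗ⁅ℂ⁆ A)
    (hf : ∀ X₁ X₂ X₃, ∑ l, ∑ m, ∑ n, alphaCoeff B b X₁ X₂ X₃ l m n •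
      (f (b l) * f (b m) * f (b n) + f (b l) * f (b n) * f (b m) + f (b m) * f (b l) * f (b n)
        + f (b m) * f (b n) * f (b l) + f (b n) * f (b l) * f (b m)
        + f (b n) * f (b m) * f (b l)) = 0) :
    ∃ ρ : Yangian B b ζ →ₐ[ℂ] A, ∀ X, ρ (Yangian.x B b ζ X) = f X ∧ ρ (Yangian.J B b ζ X) = 0 := by
  obtain ⟨φ, hφ, hφp⟩ := exists_algHom_freeAlgebra ζ
    (fun x : Gen g => match x with
      | .x X => f X
      | .J _ => 0)
  have hx : ∀ X, φ (gx X) = f X := fun X => hφ (.x X)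
  have hJ : ∀ X, φ (gJ X) = 0 := fun X => hφ (.J X)
  have hrel : ∀ ⦃u v⦄, Rel B b u v → φ u = φ v := by
    intro u v huv
    induction huv with
    | x_linear a c X₁ X₂ => simp [hx]
    | x_lie X₁ X₂ => simp [hx, Ring.lie_def]
    | J_lie X₁ X₂ => simp [hJ, Ring.lie_def]
    | J_linear a c X₁ X₂ => simp [hJ]
    | cubic h X₁ X₂ X₃ =>
      rw [Algebra.smul_def, map_mul]
      simp only [map_sum, map_smul, map_sym3, hx, smul_comm _ (1 / 24 : ℂ), ← Finset.smul_sum, hf]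
      simp [hJ, Ring.lie_def]
    | quartic h X₁ X₂ X₃ X₄ =>
      rw [Algebra.smul_def, map_mul]
      simp [map_sym3, hJ, Ring.lie_def]
  have hspec : ∀ ⦃u v⦄, SpecRel B b ζ u v →
      RingQuot.liftAlgHom ℂ ⟨φ, hrel⟩ u = RingQuot.liftAlgHom ℂ ⟨φ, hrel⟩ v := by
    rintro _ _ ⟨⟩
    -- The quotient maps over `ℂ[ħ]` and over `ℂ` have the same underlying ring homomorphism; the
    -- first one fixes the image of `ħ`.
    have e : algebraMap ℂ[X] (YangianH B b) Polynomial.X =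
        RingQuot.mkAlgHom ℂ (Rel B b) (algebraMap ℂ[X] _ Polynomial.X) := by
      rw [← AlgHom.commutes (RingQuot.mkAlgHom ℂ[X] (Rel B b))]
      exact (RingHom.congr_fun (RingQuot.mkAlgHom_coe ℂ[X] (Rel B b)) _).trans
        (RingHom.congr_fun (RingQuot.mkAlgHom_coe ℂ (Rel B b)) _).symm
    rw [e, RingQuot.liftAlgHom_mkAlgHom_apply, hφp, AlgHom.commutes, Polynomial.eval_X]
  refine ⟨RingQuot.liftAlgHom ℂ ⟨RingQuot.liftAlgHom ℂ ⟨φ, hrel⟩, hspec⟩, fun X => ?_⟩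
  simp [Yangian.x, Yangian.J, toYangian, hx, hJ]

end Evaluation

/-! ### The cubic coefficients of `𝔤_N` and the natural representation. -/

theorem half_trace_mul_commutator {s : Series} {N : ℕ} {X Y Z : Matrix (Label N) (Label N) ℂ}
    (hX : transp s X = -X) (hY : transp s Y = -Y) (hZ : transp s Z = -Z) :
    (1 / 2 : ℂ) * (X * (Y * Z - Z * Y)).trace = (X * Y * Z).trace := by
  -- The trace is alternating, so both terms of the commutator contribute equally and absorb the
  -- factor `½`.
  have h : (X * (Z * Y)).trace = -(X * Y * Z).trace := by
    rw [← mul_assoc, Matrix.trace_mul_comm (X * Z), ← mul_assoc, trace_mul_mul_swap hX hY hZ]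
  rw [mul_sub, Matrix.trace_sub, h, ← mul_assoc]
  ring

theorem alphaCoeff_halfTrace {s : Series} {N : ℕ} {L : Type} (b : L → gN s N)
    (X₁ X₂ X₃ : gN s N) (l m n : L) :
    alphaCoeff (halfTrace s N) b X₁ X₂ X₃ l m n =
      (((X₁ : Matrix (Label N) (Label N) ℂ) * b l - b l * X₁) * (X₂ * b m - b m * X₂) *
        (X₃ * b n - b n * X₃)).trace := by
  have h1 := transp_comm (transp_coe X₁) (transp_coe (b l))
  have h2 := transp_comm (transp_coe X₂) (transp_coe (b m))
  have h3 := transp_comm (transp_coe X₃) (transp_coe (b n))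
  change (1 / 2 : ℂ) * (((X₁ : Matrix (Label N) (Label N) ℂ) * b l - b l * X₁) *
    ((X₂ * b m - b m * X₂) * (X₃ * b n - b n * X₃) -
      (X₃ * b n - b n * X₃) * (X₂ * b m - b m * X₂))).trace = _
  exact half_trace_mul_commutator h1 h2 h3

theorem exists_algHom_yangian_matrix {s : Series} {N : ℕ} (h : s = .orthogonal ∨ Even N) (ζ : ℂ)
    {L : Type} [Fintype L] {b : Module.Basis L ℂ (gN s N)}
    (hb : IsOrthonormalBasis (halfTrace s N) b) :
    ∃ ρ : Yangian (halfTrace s N) b ζ →ₐ[ℂ] Matrix (Label N) (Label N) ℂ, ∀ X : gN s N,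
      ρ (Yangian.x (halfTrace s N) b ζ X) = X ∧ ρ (Yangian.J (halfTrace s N) b ζ X) = 0 := by
  refine exists_algHom_yangian (halfTrace s N) b ζ (gN s N).incl fun X₁ X₂ X₃ => ?_
  simp only [alphaCoeff_halfTrace]
  exact (hb.isCasimirFamily h).sum_trace_smul_symmetrization h
    (transp_coe X₁) (transp_coe X₂) (transp_coe X₃)

end DrinfeldYangian

theorem proposition3p2 (s : DrinfeldYangian.Series) (N : ℕ)
    (hN : (s = DrinfeldYangian.Series.orthogonal ∧ 3 ≤ N) ∨
      (s = DrinfeldYangian.Series.symplectic ∧ Even N ∧ 2 ≤ N))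
    (ζ : ℂ) {L : Type} [Fintype L] (b : Module.Basis L ℂ (DrinfeldYangian.gN s N))
    (hb : DrinfeldYangian.IsOrthonormalBasis (DrinfeldYangian.halfTrace s N) b) :
    ∃ ρ : DrinfeldYangian.Yangian (DrinfeldYangian.halfTrace s N) b ζ →ₐ[ℂ]
        Module.End ℂ (DrinfeldYangian.Label N → ℂ),
      ∀ X : DrinfeldYangian.gN s N,
        ρ (DrinfeldYangian.Yangian.x (DrinfeldYangian.halfTrace s N) b ζ X) =
            DrinfeldYangian.naturalRep s N X ∧
          ρ (DrinfeldYangian.Yangian.J (DrinfeldYangian.halfTrace s N) b ζ X) = 0 := by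
  obtain ⟨ρ, hρ⟩ := DrinfeldYangian.exists_algHom_yangian_matrix (hN.imp And.left fun h => h.2.1) ζ hb
  refine ⟨(Matrix.toLinAlgEquiv' (R := ℂ) (n := DrinfeldYangian.Label N)).toAlgHom.comp ρ,
    fun X => ⟨?_, ?_⟩⟩
  · rw [AlgHom.comp_apply, (hρ X).1]
    rfl
  · rw [AlgHom.comp_apply, (hρ X).2, map_zero]
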